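/- Fix a number of arms $K$ and a threshold $\theta\in\mathbb{R}$. For $\mu\in\mathbb{R}^K$ with $\mu_a\neq\theta$ for all $a$, consider the Gaussian bandit instance $\nu$ in which arm $a$ has law $\mathcal N(\mu_a,1)$, and let $\mathcal A_\theta(\mu)=\{a:\mu_a\ge\theta\}$ be the set of good arms, $\Delta_a=|\mu_a-\theta|$ the gap of arm $a$, and $H_1(\mu)=\sum_{a}\Delta_a^{-2}$. A strategy consists of a sampling rule, which chooses the arm $a_{t+1}$ (possibly at random) based on the history $(a_1,X_1,\dots,a_t,X_t)$ of arms pulled and rewards observed, the reward $X_{t+1}$ having conditional law $\mathcal N(\mu_{a_{t+1}},1)$ given the history and $a_{t+1}$; of a stopping time $\tau\in\mathbb{N}\cup\{+\infty\}$ with respect to the filtration $\mathcal F_t=\sigma(a_1,X_1,\dots,a_t,X_t)$; and of $\mathcal F_t$-measurable recommendations $\hat a_t\in\{1,\dots,K\}\cup\{\emptyset\}$, where $\emptyset$ means "there is no good arm". On the instance with means $\mu$, the recommendation $\hat a_t$ is erroneous if $\hat a_t\notin\mathcal A_\theta(\mu)$ when $\mathcal A_\theta(\mu)\neq\emptyset$,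 and if $\hat a_t\neq\emptyset$ when $\mathcal A_\theta(\mu)=\emptyset$. For $\delta\in(0,1)$, the strategy is $\delta$-correct if, for every Gaussian instance as above, $\mathbb{P}_\nu(\tau<\infty\text{ and }\hat a_\tau\text{ is erroneous})\le\delta$. For each $\delta\in(0,1)$ let a $\delta$-correct strategy with stopping time $\tau_\delta$ be given. Then, for every $\mu\in\mathbb{R}^K$ with $\mu_a\ne\theta$ for all $a$, $$\liminf_{\delta\to0}\frac{\mathbb{E}_\nu[\tau_\delta]}{\log(1/\delta)}\ \ge\ T^\star(\mu),\qquad T^\star(\mu)=\begin{cases}2\min_{a\in\mathcal A_\theta(\mu)}\Delta_a^{-2}&\text{if }\mathcal A_\theta(\mu)\neq\emptyset,\\ 2H_1(\mu)&\text{otherwise,}\end{cases}$$ where $\mathbb{E}_\nu[\tau_\delta]\in[0,+\infty]$. -/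

import Mathlib

open MeasureTheory ProbabilityTheory Filter Topology
open scoped ENNReal

noncomputable section

namespace GoodArm

/-- A sequence of (pulled arm, observed reward) pairs, one per round; the entry with index `n`
is the pair of round `n + 1`. -/
abbrev Path (K : ℕ) : Type := ℕ → Fin K × ℝ

/-- A history of `t` rounds `(a₁, x₁, …, aₜ, xₜ)`. -/
abbrev Hist (K t : ℕ) : Type := Fin t → Fin K × ℝ

/-- The history of the first `t` rounds of a path. -/
def hist {K : ℕ} (t : ℕ) (ω : Path K) : Hist K t := fun i => ω i

/-- The history filtration `𝓕ₜ = σ(a₁, x₁, …, aₜ, xₜ)`; `𝓕₀` is trivial. -/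
def historyFiltration (K : ℕ) : Filtration ℕ (inferInstance : MeasurableSpace (Path K)) where
  seq t := MeasurableSpace.comap (hist t) inferInstance
  mono' s t hst := by
    have h : Measurable (fun (h : Hist K t) (i : Fin s) => h (Fin.castLE hst i)) := by fun_prop
    have e : (hist s : Path K → Hist K s)
        = (fun (h : Hist K t) (i : Fin s) => h (Fin.castLE hst i)) ∘ hist t := rfl
    change MeasurableSpace.comap (hist s) _ ≤ MeasurableSpace.comap (hist t) _
    rw [e, ← MeasurableSpace.comap_comp]
    exact MeasurableSpace.comap_mono h.comap_le
  le' t := by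
    have h : Measurable (hist t : Path K → Hist K t) := by unfold hist; fun_prop
    exact h.comap_le

/-- An identification strategy with `K` arms: a sampling rule (the law of the next arm given the
history; a deterministic rule is the case of Dirac laws), a stopping time of the history
filtration, and a recommendation rule with values in the arms together with `none`, which stands
for the answer "there is no good arm". -/
structure Strategy (K : ℕ) where
  /-- The conditional law of the arm pulled in round `t + 1` given the history of `t` rounds. -/
  sample : (t : ℕ) → Kernel (Hist K t) (Fin K)
  isMarkovKernel_sample : ∀ t, IsMarkovKernel (sample t)
  /-- The number of rounds after which the strategy stops. -/
  tau : Path K → ℕ∞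
  isStoppingTime_tau : IsStoppingTime (historyFiltration K) tau
  /-- The answer recommended after `t` rounds. -/
  recommend : (t : ℕ) → Hist K t → Option (Fin K)
  measurable_recommend : ∀ t, Measurable[_, ⊤] (recommend t)

attribute [instance] Strategy.isMarkovKernel_sample

/-- The reward of arm `a` has law `𝒩(μ a, 1)`. -/
def rewardKernel {K : ℕ} (μ : Fin K → ℝ) : Kernel (Fin K) ℝ where
  toFun a := gaussianReal (μ a) 1
  measurable' := measurable_of_finite _

instance {K : ℕ} (μ : Fin K → ℝ) : IsMarkovKernel (rewardKernel μ) :=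
  ⟨fun a => inferInstanceAs (IsProbabilityMeasure (gaussianReal (μ a) 1))⟩

namespace Strategy

variable {K : ℕ} (S : Strategy K)

/-- The conditional law of the pair (arm, reward) of round `t + 1` given the history of `t`
rounds: the arm is drawn from the sampling rule, then the reward from the law of that arm. -/
def step (μ : Fin K → ℝ) (t : ℕ) : Kernel (Hist K t) (Fin K × ℝ) :=
  S.sample t ⊗ₖ Kernel.prodMkLeft (Hist K t) (rewardKernel μ)

instance (μ : Fin K → ℝ) (t : ℕ) : IsMarkovKernel (S.step μ t) := by
  unfold step; infer_instance

/-- A history indexed by `{0, …, n}`, read as a history of `n + 1` rounds. -/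
def ofIic (n : ℕ) (h : (i : Finset.Iic n) → Fin K × ℝ) : Hist K (n + 1) :=
  fun i => h ⟨i, Finset.mem_Iic.2 (Nat.lt_succ_iff.1 i.2)⟩

lemma measurable_ofIic (n : ℕ) : Measurable (ofIic (K := K) n) := by
  unfold ofIic; fun_prop

/-- The law `ℙ_ν` of the infinite sequence of arms and rewards on the Gaussian instance with
means `μ`. -/
def law (μ : Fin K → ℝ) : Measure (Path K) :=
  Kernel.trajMeasure (X := fun _ => Fin K × ℝ) (S.step μ 0 Fin.elim0)
    (fun n => (S.step μ (n + 1)).comap (ofIic n) (measurable_ofIic n))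

/-- The expected number of samples `𝔼_ν[τ]`, which is infinite if `τ` is not integrable. -/
def expectedSamples (μ : Fin K → ℝ) : ℝ≥0∞ := ∫⁻ ω, (S.tau ω : ℝ≥0∞) ∂(S.law μ)

end Strategy

/-- The set of good arms of the instance with means `μ`, for the threshold `θ`. -/
def goodArms {K : ℕ} (θ : ℝ) (μ : Fin K → ℝ) : Finset (Fin K) :=
  Finset.univ.filter fun a => θ ≤ μ a

open Classical in
/-- The set of erroneous answers: everything but the good arms if there is a good arm,
and everything but `none` otherwise. -/
def wrongAnswers {K : ℕ} (θ : ℝ) (μ : Fin K → ℝ) : Set (Option (Fin K)) :=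
  if (goodArms θ μ).Nonempty then {r | r = none ∨ ∃ a, a ∉ goodArms θ μ ∧ r = some a}
  else {r | r ≠ none}

/-- The event that the strategy stops and then recommends an erroneous answer. -/
def Strategy.errorEvent {K : ℕ} (S : Strategy K) (θ : ℝ) (μ : Fin K → ℝ) : Set (Path K) :=
  {ω | ∃ t : ℕ, S.tau ω = t ∧ S.recommend t (hist t ω) ∈ wrongAnswers θ μ}

/-- `δ`-correctness: on each unit-variance Gaussian instance with no mean equal to the threshold,
the probability to stop and be wrong is at most `δ`. -/
def Strategy.IsCorrect {K : ℕ} (S : Strategy K) (θ δ : ℝ) : Prop :=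
  ∀ μ : Fin K → ℝ, (∀ a, μ a ≠ θ) → S.law μ (S.errorEvent θ μ) ≤ ENNReal.ofReal δ

/-- The gap `Δₐ` of arm `a`. -/
def gap {K : ℕ} (θ : ℝ) (μ : Fin K → ℝ) (a : Fin K) : ℝ := |μ a - θ|

/-- The complexity `H₁(μ)`. -/
def complexityH1 {K : ℕ} (θ : ℝ) (μ : Fin K → ℝ) : ℝ := ∑ a, (gap θ μ a ^ 2)⁻¹

open Classical in
/-- The characteristic time `T⋆(μ)`. -/
def characteristicTime {K : ℕ} (θ : ℝ) (μ : Fin K → ℝ) : ℝ :=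
  if h : (goodArms θ μ).Nonempty then 2 * (goodArms θ μ).inf' h fun a => (gap θ μ a ^ 2)⁻¹
  else 2 * complexityH1 θ μ

end GoodArm

end

namespace GoodArm

variable {K : ℕ}

/-! Move the mean of one arm `a` to a value `l` across the threshold, so that an answer right under
`μ` becomes wrong. By correctness it then has probability at most `δ` under the moved instance, so
under `μ` it is unlikely unless the two instances have been told apart, which takes almost `2 / Δₐ²
* log (1 / δ)` pulls of `a`. The comparison (`exp_logLik_le`, `law_fewPullsEvent_le`) is pointwise
on histories. Where the log-likelihood ratio is at most `c`, `μ` is dominated by `exp c` times the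
moved instance. Elsewhere it is dominated by a small multiple of a third instance, whose mean for
`a` is extrapolated beyond `μ a`: a Chernoff bound in the form of a tilt. Thus no integrability of
`τ` is needed. If good arms exist, the answer is with high probability some good arm `a`, and `τ` is
at least its number of pulls. Otherwise the answer is almost always `none`, raising any single arm
makes it wrong, and the required pulls add up. -/

lemma measurable_hist (t : ℕ) : Measurable (hist t : Path K → Hist K t) := by
  unfold hist; fun_prop

lemma hist_succ (t : ℕ) (ω : Path K) :
    hist (t + 1) ω = Fin.snoc (α := fun _ => Fin K × ℝ) (hist t ω) (ω t) := by
  ext1 i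
  induction i using Fin.lastCases with
  | last => simp [hist]
  | cast i => simp [hist]

lemma measurable_snoc (t : ℕ) : Measurable fun q : Hist K t × (Fin K × ℝ) =>
    (Fin.snoc (α := fun _ => Fin K × ℝ) q.1 q.2 : Hist K (t + 1)) := by
  refine measurable_pi_iff.2 fun i => ?_
  induction i using Fin.lastCases with
  | last => simpa using measurable_snd
  | cast i =>
    simp only [Fin.snoc_castSucc]
    exact (measurable_pi_apply i).comp measurable_fst

/-! ### Likelihoods and pull counts. -/

/-- The log-density of a history under the means `μ` with respect to the means `0`. -/
noncomputable def logLik (μ : Fin K → ℝ) {t : ℕ} (h : Hist K t) : ℝ :=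
  ∑ i, (μ (h i).1 * (h i).2 - μ (h i).1 ^ 2 / 2)

/-- The number of pulls of arm `a` in a history. -/
def pulls (a : Fin K) {t : ℕ} (h : Hist K t) : ℕ :=
  ∑ i, if (h i).1 = a then 1 else 0

lemma sum_pulls {t : ℕ} (h : Hist K t) : ∑ a, pulls a h = t := by
  unfold pulls
  rw [Finset.sum_comm]
  simp

lemma pulls_le {t : ℕ} (a : Fin K) (h : Hist K t) : pulls a h ≤ t :=
  (Finset.single_le_sum (f := fun a => pulls a h) (fun _ _ => Nat.zero_le _)
    (Finset.mem_univ a)).trans (sum_pulls h).le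

lemma measurable_pulls (a : Fin K) (t : ℕ) : Measurable (pulls a : Hist K t → ℕ) := by
  unfold pulls
  refine Finset.measurable_sum _ fun i _ => ?_
  exact (measurable_of_finite fun b : Fin K => if b = a then 1 else 0).comp
    (measurable_fst.comp (measurable_pi_apply i))

lemma measurable_logLik_term (μ : Fin K → ℝ) :
    Measurable fun y : Fin K × ℝ => μ y.1 * y.2 - μ y.1 ^ 2 / 2 := by
  have : Measurable fun y : Fin K × ℝ => μ y.1 := (measurable_of_finite μ).comp measurable_fst
  fun_prop

lemma measurable_logLik (μ : Fin K → ℝ) (t : ℕ) : Measurable (logLik μ : Hist K t → ℝ) := by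
  unfold logLik
  exact Finset.measurable_sum _ fun i _ => (measurable_logLik_term μ).comp (measurable_pi_apply i)

lemma logLik_snoc (μ : Fin K → ℝ) {t : ℕ} (h : Hist K t) (y : Fin K × ℝ) :
    logLik μ (Fin.snoc (α := fun _ => Fin K × ℝ) h y : Hist K (t + 1)) =
      logLik μ h + (μ y.1 * y.2 - μ y.1 ^ 2 / 2) := by
  simp only [logLik, Fin.sum_univ_castSucc, Fin.snoc_castSucc, Fin.snoc_last]

/-- Isolates the dependence on `l`: the first sum is common to all instances differing only in arm
`a`, so it cancels in likelihood ratios. -/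
lemma logLik_update (μ : Fin K → ℝ) (a : Fin K) (l : ℝ) {t : ℕ} (h : Hist K t) :
    logLik (Function.update μ a l) h =
      (∑ i, if (h i).1 = a then 0 else μ (h i).1 * (h i).2 - μ (h i).1 ^ 2 / 2)
        + l * (∑ i, if (h i).1 = a then (h i).2 else 0) - pulls a h * (l ^ 2 / 2) := by
  simp only [logLik, pulls, Nat.cast_sum, Finset.mul_sum, Finset.sum_mul]
  rw [← Finset.sum_add_distrib, ← Finset.sum_sub_distrib]
  refine Finset.sum_congr rfl fun i _ => ?_
  by_cases hi : (h i).1 = a <;> simp [hi]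

/-- A pointwise comparison of three likelihoods that differ in the mean of a single arm. -/
lemma exp_logLik_le (μ : Fin K → ℝ) (a : Fin K) (l : ℝ) {p : ℝ} (hp : 1 ≤ p) (c : ℝ) {M : ℝ}
    {t : ℕ} (h : Hist K t) (hM : (pulls a h : ℝ) ≤ M) :
    Real.exp (logLik μ h) ≤
      Real.exp c * Real.exp (logLik (Function.update μ a l) h) +
      Real.exp (-((p - 1) * (c - M * p * (μ a - l) ^ 2 / 2))) *
        Real.exp (logLik (Function.update μ a (l + p * (μ a - l))) h) := by
  have e := logLik_update μ a (μ a) h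
  rw [Function.update_eq_self] at e
  rw [e, logLik_update, logLik_update]
  set B := ∑ i, if (h i).1 = a then 0 else μ (h i).1 * (h i).2 - μ (h i).1 ^ 2 / 2
  set X := ∑ i, if (h i).1 = a then (h i).2 else 0
  set N : ℝ := (pulls a h : ℝ)
  set d := μ a - l with hd
  have hm : μ a = l + d := by rw [hd]; ring
  rw [hm, ← Real.exp_add, ← Real.exp_add]
  -- The quantity compared with `c` is the log-likelihood ratio `Λ` of `μ` to the mean `l`. The
  -- log-ratio of the third instance to `μ` is `(p - 1) * (Λ - N * p * d ^ 2 / 2)`.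
  rcases le_total (d * X - N * (2 * l * d + d ^ 2) / 2) c with hc | hc
  · refine le_add_of_le_of_nonneg (Real.exp_le_exp.2 ?_) (Real.exp_pos _).le
    nlinarith
  · refine le_add_of_nonneg_of_le (Real.exp_pos _).le (Real.exp_le_exp.2 ?_)
    have h1 := mul_nonneg (sub_nonneg.2 hp) (sub_nonneg.2 hc)
    have h2 : 0 ≤ (M - N) * ((p - 1) * p * d ^ 2 / 2) :=
      mul_nonneg (sub_nonneg.2 hM) (by have := sub_nonneg.2 hp; positivity)
    nlinarith

/-! ### Density of the law of a history. -/

lemma lintegral_gaussianReal_one (m : ℝ) {f : ℝ → ℝ≥0∞} (hf : Measurable f) :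
    ∫⁻ x, f x ∂gaussianReal m 1 =
      ∫⁻ x, f x * ENNReal.ofReal (Real.exp (m * x - m ^ 2 / 2)) ∂gaussianReal 0 1 := by
  rw [gaussianReal_of_var_ne_zero _ one_ne_zero, gaussianReal_of_var_ne_zero _ one_ne_zero,
    lintegral_withDensity_eq_lintegral_mul _ (measurable_gaussianPDF _ _) hf,
    lintegral_withDensity_eq_lintegral_mul _ (measurable_gaussianPDF _ _) (by fun_prop)]
  refine lintegral_congr fun x => ?_
  have : gaussianPDF m 1 x =
      gaussianPDF 0 1 x * ENNReal.ofReal (Real.exp (m * x - m ^ 2 / 2)) := by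
    rw [gaussianPDF, gaussianPDF, ← ENNReal.ofReal_mul (gaussianPDFReal_nonneg _ _ _)]
    simp only [gaussianPDFReal, mul_assoc, ← Real.exp_add]
    congr 4
    simp only [NNReal.coe_one]
    ring
  simp only [Pi.mul_apply, this]
  ring

namespace Strategy

variable (S : Strategy K)

instance (μ : Fin K → ℝ) : IsProbabilityMeasure (S.law μ) := by
  unfold law; infer_instance

lemma lintegral_step (μ : Fin K → ℝ) (t : ℕ) (h : Hist K t) {f : Fin K × ℝ → ℝ≥0∞}
    (hf : Measurable f) :
    ∫⁻ y, f y ∂S.step μ t h =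
      ∫⁻ y, f y * ENNReal.ofReal (Real.exp (μ y.1 * y.2 - μ y.1 ^ 2 / 2)) ∂S.step 0 t h := by
  have hl := measurable_logLik_term μ
  rw [step, step, Kernel.lintegral_compProd _ _ _ hf,
    Kernel.lintegral_compProd _ _ _ (by fun_prop)]
  refine lintegral_congr fun a => ?_
  exact lintegral_gaussianReal_one (μ a) (f := fun x => f (a, x)) (by fun_prop)

lemma lintegral_law_succ (μ : Fin K → ℝ) (t : ℕ) {G : Hist K t × (Fin K × ℝ) → ℝ≥0∞}
    (hG : Measurable G) :
    ∫⁻ ω, G (hist t ω, ω t) ∂S.law μ =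
      ∫⁻ ω, ∫⁻ y, G (hist t ω, y) ∂S.step μ t (hist t ω) ∂S.law μ := by
  cases t with
  -- `trajMeasure` takes the first round as an initial measure, not as a kernel, hence the separate
  -- case.
  | zero =>
    have e : ∀ ω : Path K, hist 0 ω = Fin.elim0 := fun ω => Subsingleton.elim _ _
    simp only [e, lintegral_const, measure_univ, mul_one]
    have hm : (S.law μ).map (fun ω => ω 0) = S.step μ 0 Fin.elim0 := by
      have h0 : (fun ω : Path K => ω 0) =
        (fun x : ((i : Finset.Iic 0) → Fin K × ℝ) => x ⟨0, by simp⟩) ∘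
          Preorder.frestrictLe 0 := rfl
      rw [h0, ← Measure.map_map (by fun_prop) (by fun_prop), law, Kernel.trajMeasure,
        Measure.map_comp _ _ (by fun_prop), Kernel.traj_map_frestrictLe, Kernel.partialTraj_self,
        Measure.id_comp, Measure.map_map (by fun_prop) (by fun_prop)]
      exact Measure.map_id
    rw [← hm, lintegral_map (by fun_prop) (by fun_prop)]
  | succ n =>
    have h := Kernel.map_frestrictLe_trajMeasure_compProd_eq_map_trajMeasure
      (X := fun _ => Fin K × ℝ) (μ₀ := S.step μ 0 Fin.elim0)
      (κ := fun n => (S.step μ (n + 1)).comap (ofIic n) (measurable_ofIic n)) (a := n)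
    have hG' : Measurable fun q : ((i : Finset.Iic n) → Fin K × ℝ) × (Fin K × ℝ) =>
        G (ofIic n q.1, q.2) :=
      hG.comp (((measurable_ofIic n).comp measurable_fst).prodMk measurable_snd)
    have h' := congrArg (fun m => ∫⁻ q, G (ofIic n q.1, q.2) ∂m) h
    rw [Measure.lintegral_compProd hG', lintegral_map hG'.lintegral_kernel_prod_right' (by fun_prop),
      lintegral_map hG' (by fun_prop)] at h'
    exact h'.symm

/-- The law of a history has the density `exp (logLik μ)` with respect to the means `0`. -/
lemma lintegral_law_hist (μ : Fin K → ℝ) (t : ℕ) {g : Hist K t → ℝ≥0∞} (hg : Measurable g) :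
    ∫⁻ ω, g (hist t ω) ∂S.law μ =
      ∫⁻ ω, g (hist t ω) * ENNReal.ofReal (Real.exp (logLik μ (hist t ω))) ∂S.law 0 := by
  induction t with
  | zero =>
    have e : ∀ ω : Path K, hist 0 ω = Fin.elim0 := fun ω => Subsingleton.elim _ _
    simp [e, logLik]
  | succ t ih =>
    have hs := measurable_snoc (K := K) t
    have hl := measurable_logLik μ (t + 1)
    have ht := measurable_logLik_term μ
    simp only [hist_succ]
    rw [S.lintegral_law_succ μ t (G := fun q => g (Fin.snoc (α := fun _ => Fin K × ℝ) q.1 q.2))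
        (hg.comp hs),
      S.lintegral_law_succ 0 t (G := fun q => g (Fin.snoc (α := fun _ => Fin K × ℝ) q.1 q.2) *
        ENNReal.ofReal (Real.exp (logLik μ
          (Fin.snoc (α := fun _ => Fin K × ℝ) q.1 q.2 : Hist K (t + 1)))))
        ((hg.comp hs).mul (ENNReal.measurable_ofReal.comp
          (Real.measurable_exp.comp (hl.comp hs))))]
    have hi : Measurable fun h : Hist K t =>
        ∫⁻ y, g (Fin.snoc (α := fun _ => Fin K × ℝ) h y) ∂S.step μ t h :=
      (hg.comp hs).lintegral_kernel_prod_right'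
    rw [ih hi]
    refine lintegral_congr fun ω => ?_
    have hy : Measurable fun y : Fin K × ℝ =>
        g (Fin.snoc (α := fun _ => Fin K × ℝ) (hist t ω) y) :=
      (hg.comp hs).comp measurable_prodMk_left
    rw [S.lintegral_step μ t _ hy, ← lintegral_mul_const _ (by fun_prop)]
    refine lintegral_congr fun y => ?_
    rw [logLik_snoc, Real.exp_add, ENNReal.ofReal_mul (Real.exp_pos _).le]
    ring

/-! ### Change of measure up to the stopping time. -/

/-- The event that the strategy stops with an answer in `R`. -/
def stopEvent (R : Set (Option (Fin K))) : Set (Path K) :=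
  {ω | ∃ t : ℕ, S.tau ω = t ∧ S.recommend t (hist t ω) ∈ R}

/-- The event that the strategy stops with an answer in `R` after at most `M` pulls of `a`. -/
def fewPullsEvent (R : Set (Option (Fin K))) (a : Fin K) (M : ℝ) : Set (Path K) :=
  {ω | ∃ t : ℕ, S.tau ω = t ∧ S.recommend t (hist t ω) ∈ R ∧ (pulls a (hist t ω) : ℝ) ≤ M}

/-- Stopping at `t` is decided by the first `t` rounds, so the density of the history law applies to
this event. -/
lemma exists_hist_preimage_eq (R : Set (Option (Fin K))) (a : Fin K) (M : ℝ) (t : ℕ) :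
    ∃ B : Set (Hist K t), MeasurableSet B ∧ (∀ h ∈ B, (pulls a h : ℝ) ≤ M) ∧
      hist t ⁻¹' B = {ω | S.tau ω = t ∧ S.recommend t (hist t ω) ∈ R ∧
        (pulls a (hist t ω) : ℝ) ≤ M} := by
  obtain ⟨C, hC, hCt⟩ : MeasurableSet[(historyFiltration K) t] {ω | S.tau ω = t} :=
    S.isStoppingTime_tau.measurableSet_eq t
  have hp : MeasurableSet {h : Hist K t | (pulls a h : ℝ) ≤ M} :=
    measurableSet_le (measurable_from_top.comp (measurable_pulls a t)) measurable_const
  refine ⟨C ∩ (S.recommend t ⁻¹' R ∩ {h | (pulls a h : ℝ) ≤ M}),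
    hC.inter ((S.measurable_recommend t trivial).inter hp), fun h hh => hh.2.2, ?_⟩
  rw [Set.preimage_inter, hCt]
  rfl

lemma fewPullsEvent_eq_iUnion (R : Set (Option (Fin K))) (a : Fin K) (M : ℝ) :
    S.fewPullsEvent R a M = ⋃ t : ℕ, {ω | S.tau ω = t ∧ S.recommend t (hist t ω) ∈ R ∧
        (pulls a (hist t ω) : ℝ) ≤ M} := by
  ext ω; simp [fewPullsEvent]

lemma measurableSet_fewPullsEvent_at (R : Set (Option (Fin K))) (a : Fin K) (M : ℝ) (t : ℕ) :
    MeasurableSet {ω | S.tau ω = t ∧ S.recommend t (hist t ω) ∈ R ∧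
        (pulls a (hist t ω) : ℝ) ≤ M} := by
  obtain ⟨B, hB, -, hBt⟩ := S.exists_hist_preimage_eq R a M t
  rw [← hBt]
  exact measurable_hist t hB

lemma measurableSet_fewPullsEvent (R : Set (Option (Fin K))) (a : Fin K) (M : ℝ) :
    MeasurableSet (S.fewPullsEvent R a M) := by
  rw [fewPullsEvent_eq_iUnion]
  exact MeasurableSet.iUnion fun t => S.measurableSet_fewPullsEvent_at R a M t

lemma law_fewPullsEvent (μ : Fin K → ℝ) (R : Set (Option (Fin K))) (a : Fin K) (M : ℝ) :
    S.law μ (S.fewPullsEvent R a M) = ∑' t : ℕ, S.law μ {ω | S.tau ω = t ∧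
      S.recommend t (hist t ω) ∈ R ∧ (pulls a (hist t ω) : ℝ) ≤ M} := by
  rw [fewPullsEvent_eq_iUnion, measure_iUnion _ fun t => S.measurableSet_fewPullsEvent_at R a M t]
  intro s t hst
  refine Set.disjoint_left.2 fun ω hs ht => hst ?_
  exact_mod_cast hs.1.symm.trans ht.1

/-- Change of measure: the probability of stopping early with an answer in `R` under `μ` is
controlled by the probability of answering in `R` when the mean of arm `a` is replaced. -/
lemma law_fewPullsEvent_le (μ : Fin K → ℝ) (R : Set (Option (Fin K))) (a : Fin K) (M l : ℝ)
    {p : ℝ} (hp : 1 ≤ p) (c : ℝ) :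
    S.law μ (S.fewPullsEvent R a M) ≤
      ENNReal.ofReal (Real.exp c) * S.law (Function.update μ a l) (S.stopEvent R) +
      ENNReal.ofReal (Real.exp (-((p - 1) * (c - M * p * (μ a - l) ^ 2 / 2)))) := by
  set C := ENNReal.ofReal (Real.exp c)
  set D := ENNReal.ofReal (Real.exp (-((p - 1) * (c - M * p * (μ a - l) ^ 2 / 2))))
  set ν := Function.update μ a (l + p * (μ a - l))
  have key : S.law μ (S.fewPullsEvent R a M) ≤
      C * S.law (Function.update μ a l) (S.fewPullsEvent R a M)
        + D * S.law ν (S.fewPullsEvent R a M) := by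
    simp only [law_fewPullsEvent]
    rw [← ENNReal.tsum_mul_left, ← ENNReal.tsum_mul_left, ← ENNReal.tsum_add]
    refine ENNReal.tsum_le_tsum fun t => ?_
    obtain ⟨B, hB, hBM, hBt⟩ := S.exists_hist_preimage_eq R a M t
    have hlaw : ∀ μ' : Fin K → ℝ, S.law μ' (hist t ⁻¹' B) = ∫⁻ ω, B.indicator 1 (hist t ω) *
        ENNReal.ofReal (Real.exp (logLik μ' (hist t ω))) ∂S.law 0 := fun μ' => by
      rw [← S.lintegral_law_hist μ' t (measurable_one.indicator hB),
        ← lintegral_indicator_one (measurable_hist t hB)]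
      rfl
    have hm : ∀ μ' : Fin K → ℝ, Measurable fun ω : Path K => B.indicator 1 (hist t ω) *
        ENNReal.ofReal (Real.exp (logLik μ' (hist t ω))) := fun μ' =>
      ((measurable_one.indicator hB).mul (ENNReal.measurable_ofReal.comp
        (Real.measurable_exp.comp (measurable_logLik μ' t)))).comp (measurable_hist t)
    rw [← hBt, hlaw, hlaw, hlaw, ← lintegral_const_mul _ (hm _), ← lintegral_const_mul _ (hm _),
      ← lintegral_add_left ((hm _).const_mul _)]
    refine lintegral_mono fun ω => ?_
    by_cases hω : hist t ω ∈ B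
    · simp only [Set.indicator_of_mem hω, Pi.one_apply, one_mul, C, D]
      rw [← ENNReal.ofReal_mul (Real.exp_pos _).le, ← ENNReal.ofReal_mul (Real.exp_pos _).le,
        ← ENNReal.ofReal_add (by positivity) (by positivity)]
      exact ENNReal.ofReal_le_ofReal (exp_logLik_le μ a l hp c _ (hBM _ hω))
    · simp [Set.indicator_of_notMem hω]
  refine key.trans (add_le_add (mul_le_mul_right (measure_mono ?_) _) ?_)
  · rintro ω ⟨t, h1, h2, -⟩
    exact ⟨t, h1, h2⟩
  -- The extrapolated instance enters only through total mass one; correctness there is never used.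
  · exact mul_le_of_le_one_right' prob_le_one

lemma measurableSet_stopEvent (R : Set (Option (Fin K))) : MeasurableSet (S.stopEvent R) := by
  have e : S.stopEvent R =
      ⋃ t : ℕ, {ω | S.tau ω = t} ∩ hist t ⁻¹' (S.recommend t ⁻¹' R) := by
    ext ω; simp [stopEvent]
  rw [e]
  exact MeasurableSet.iUnion fun t =>
    ((historyFiltration K).le t _ (S.isStoppingTime_tau.measurableSet_eq t)).inter
      (measurable_hist t (S.measurable_recommend t trivial))

/-- The expected number of samples is at least the sum over the arms of
any thresholds, weighted by the probability not to stop before exceeding them. -/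
lemma sum_le_expectedSamples (μ : Fin K → ℝ) (M : Fin K → ℝ) :
    ∑ a, ENNReal.ofReal (M a) * S.law μ (S.fewPullsEvent Set.univ a (M a))ᶜ ≤
      S.expectedSamples μ := by
  have hE := fun a => (S.measurableSet_fewPullsEvent Set.univ a (M a)).compl
  simp only [← fun a => lintegral_indicator_const (μ := S.law μ) (hE a) (ENNReal.ofReal (M a))]
  rw [← lintegral_finsetSum _ fun a _ => measurable_const.indicator (hE a), expectedSamples]
  refine lintegral_mono fun ω => ?_
  cases h : S.tau ω with
  | top => simp
  | coe t =>
    calc _ ≤ ∑ a, (pulls a (hist t ω) : ℝ≥0∞) := by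
          refine Finset.sum_le_sum fun a _ => ?_
          refine Set.indicator_apply_le' (fun ha => ?_) fun _ => zero_le
          have : M a ≤ pulls a (hist t ω) := by
            by_contra! hlt
            exact ha ⟨t, h, trivial, hlt.le⟩
          exact (ENNReal.ofReal_le_ofReal this).trans_eq (ENNReal.ofReal_natCast _)
      _ = _ := by
          rw [← Nat.cast_sum, sum_pulls]
          simp

/-- Markov's inequality for the stopping time. -/
lemma mul_le_expectedSamples (μ : Fin K → ℝ) {M : ℝ} {E : Set (Path K)} (hE : MeasurableSet E)
    (h : ∀ ω, ∀ t : ℕ, S.tau ω = t → (t : ℝ) ≤ M → ω ∈ E) :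
    ENNReal.ofReal M * S.law μ Eᶜ ≤ S.expectedSamples μ := by
  rw [← lintegral_indicator_const hE.compl, expectedSamples]
  refine lintegral_mono fun ω => ?_
  refine Set.indicator_apply_le' (fun hω => ?_) fun _ => zero_le
  cases ht : S.tau ω with
  | top => simp
  | coe t =>
    have : M ≤ t := by
      by_contra! hlt
      exact hω (h ω t ht hlt.le)
    simpa using (ENNReal.ofReal_le_ofReal this).trans_eq (ENNReal.ofReal_natCast _)

end Strategy

/-! ### Asymptotics as `δ` tends to zero. -/

lemma tendsto_log_one_div : Tendsto (fun δ : ℝ => Real.log (1 / δ)) (𝓝[>] 0) atTop := by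
  simp only [one_div]
  exact Real.tendsto_log_atTop.comp tendsto_inv_nhdsGT_zero

lemma eventually_mem_Ioo : ∀ᶠ δ : ℝ in 𝓝[>] 0, 0 < δ ∧ δ < 1 :=
  Ioo_mem_nhdsGT one_pos

lemma tendsto_ofReal_exp_neg_mul_log {k : ℝ} (hk : 0 < k) :
    Tendsto (fun δ : ℝ => ENNReal.ofReal (Real.exp (-(k * Real.log (1 / δ))))) (𝓝[>] 0)
      (𝓝 0) := by
  have h : Tendsto (fun δ : ℝ => Real.exp (-(k * Real.log (1 / δ)))) (𝓝[>] 0) (𝓝 0) :=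
    Real.tendsto_exp_neg_atTop_nhds_zero.comp (tendsto_log_one_div.const_mul_atTop hk)
  simpa using ENNReal.tendsto_ofReal h

/-- If answers in `R` have probability at most `δ` once the mean of arm `a` is replaced by `l`,
then under `μ` such answers are unlikely unless arm `a` is pulled often. -/
lemma tendsto_law_fewPullsEvent (S : ℝ → Strategy K) (μ : Fin K → ℝ) (R : Set (Option (Fin K)))
    (a : Fin K) (l : ℝ)
    (hR : ∀ δ, 0 < δ → δ < 1 →
      (S δ).law (Function.update μ a l) ((S δ).stopEvent R) ≤ ENNReal.ofReal δ)
    {r : ℝ} (hr : 0 ≤ r) (hr' : r * (μ a - l) ^ 2 < 2) :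
    Tendsto (fun δ => (S δ).law μ ((S δ).fewPullsEvent R a (r * Real.log (1 / δ))))
      (𝓝[>] 0) (𝓝 0) := by
  set q := r * (μ a - l) ^ 2 / 2 with hq
  have hq0 : 0 ≤ q := by positivity
  have hq1 : q < 1 := by rw [hq]; linarith
  -- Since `1 - p * q = 2 * k`, taking `c = (1 - k) * L` makes the two error terms `exp (-k * L)`
  -- and `exp (-(p - 1) * k * L)`; both vanish because `q < 1`.
  set p := 2 / (1 + q) with hp
  have hp1 : 1 < p := by rw [hp, lt_div_iff₀ (by positivity)]; linarith
  set k := (1 - q) / (2 * (1 + q)) with hk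
  have hk0 : 0 < k := div_pos (by linarith) (by positivity)
  have hpq : 1 - k - p * q = k := by rw [hk, hp]; field_simp; ring
  have hlim := (tendsto_ofReal_exp_neg_mul_log hk0).add
    (tendsto_ofReal_exp_neg_mul_log (mul_pos (sub_pos.2 hp1) hk0))
  rw [add_zero] at hlim
  refine tendsto_of_tendsto_of_tendsto_of_le_of_le' tendsto_const_nhds hlim
    (Eventually.of_forall fun _ => zero_le) ?_
  filter_upwards [eventually_mem_Ioo] with δ hδ
  set L := Real.log (1 / δ) with hL
  refine ((S δ).law_fewPullsEvent_le μ R a (r * L) l hp1.le ((1 - k) * L)).trans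
    (add_le_add ?_ (le_of_eq ?_))
  · refine (mul_le_mul_right (hR δ hδ.1 hδ.2) _).trans_eq ?_
    have hδe : δ = Real.exp (-L) := by
      rw [hL, one_div, Real.log_inv, neg_neg, Real.exp_log hδ.1]
    rw [← ENNReal.ofReal_mul (Real.exp_pos _).le]
    have hexp : Real.exp ((1 - k) * L) * Real.exp (-L) = Real.exp (-(k * L)) := by
      rw [← Real.exp_add]
      ring_nf
    rw [← hexp, ← hδe]
  · have : (1 - k) * L - r * L * p * (μ a - l) ^ 2 / 2 = (1 - k - p * q) * L := by
      rw [hq]; ring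
    rw [this, hpq, mul_assoc]

lemma tendsto_law_compl (S : ℝ → Strategy K) (μ : Fin K → ℝ) {E : ℝ → Set (Path K)}
    (hE : ∀ δ, MeasurableSet (E δ))
    (h : Tendsto (fun δ => (S δ).law μ (E δ)) (𝓝[>] 0) (𝓝 0)) :
    Tendsto (fun δ => (S δ).law μ (E δ)ᶜ) (𝓝[>] 0) (𝓝 1) := by
  simp only [fun δ => prob_compl_eq_one_sub (μ := (S δ).law μ) (hE δ)]
  simpa using ENNReal.Tendsto.sub tendsto_const_nhds h (Or.inl ENNReal.one_ne_top)

lemma sum_le_liminf_expectedSamples (S : ℝ → Strategy K) (μ : Fin K → ℝ) {ι : Type*}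
    (s : Finset ι) {r : ι → ℝ} (hr : ∀ i ∈ s, 0 ≤ r i) {w : ι → ℝ → ℝ≥0∞}
    (hw : ∀ i ∈ s, Tendsto (w i) (𝓝[>] 0) (𝓝 1))
    (h : ∀ᶠ δ in 𝓝[>] 0, ∑ i ∈ s, ENNReal.ofReal (r i * Real.log (1 / δ)) * w i δ ≤
      (S δ).expectedSamples μ) :
    ENNReal.ofReal (∑ i ∈ s, r i) ≤
      liminf (fun δ : ℝ => (S δ).expectedSamples μ / ENNReal.ofReal (Real.log (1 / δ)))
        (𝓝[>] (0 : ℝ)) := by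
  have hlim : Tendsto (fun δ => ∑ i ∈ s, ENNReal.ofReal (r i) * w i δ) (𝓝[>] 0)
      (𝓝 (∑ i ∈ s, ENNReal.ofReal (r i) * 1)) :=
    tendsto_finsetSum _ fun i hi =>
      ENNReal.Tendsto.const_mul (hw i hi) (Or.inl one_ne_zero)
  simp only [mul_one] at hlim
  rw [ENNReal.ofReal_sum_of_nonneg hr, ← hlim.liminf_eq]
  refine liminf_le_liminf ?_
  filter_upwards [h, tendsto_log_one_div.eventually_gt_atTop 0] with δ hδ hL
  rw [ENNReal.le_div_iff_mul_le (Or.inl (by simpa using hL)) (Or.inl ENNReal.ofReal_ne_top),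
    Finset.sum_mul]
  refine le_trans (le_of_eq (Finset.sum_congr rfl fun i hi => ?_)) hδ
  rw [ENNReal.ofReal_mul (hr i hi)]
  ring

/-- Correctness excludes means equal to `θ`, so the moved mean must lie strictly beyond it; the
strict inequality leaves room by continuity. -/
lemma exists_lt_mul_sub_sq_lt {θ m r : ℝ} (h : r * (m - θ) ^ 2 < 2) :
    ∃ l < θ, r * (m - l) ^ 2 < 2 := by
  have hc : Continuous fun l : ℝ => r * (m - l) ^ 2 := by fun_prop
  have := (hc.tendsto θ).eventually (gt_mem_nhds h)
  have hm : ∀ᶠ l in 𝓝[Set.Iio θ] θ, l ∈ Set.Iio θ := self_mem_nhdsWithin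
  exact (hm.and (nhdsWithin_le_nhds this)).exists

lemma exists_gt_mul_sub_sq_lt {θ m r : ℝ} (h : r * (m - θ) ^ 2 < 2) :
    ∃ l > θ, r * (m - l) ^ 2 < 2 := by
  have hc : Continuous fun l : ℝ => r * (m - l) ^ 2 := by fun_prop
  have := (hc.tendsto θ).eventually (gt_mem_nhds h)
  have hm : ∀ᶠ l in 𝓝[Set.Ioi θ] θ, l ∈ Set.Ioi θ := self_mem_nhdsWithin
  exact (hm.and (nhdsWithin_le_nhds this)).exists

lemma law_update_stopEvent_le {S : Strategy K} {θ δ : ℝ} (hS : S.IsCorrect θ δ)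
    {μ : Fin K → ℝ} (hμ : ∀ a, μ a ≠ θ) {a : Fin K} {l : ℝ} (hl : l ≠ θ)
    {R : Set (Option (Fin K))} (hR : R ⊆ wrongAnswers θ (Function.update μ a l)) :
    S.law (Function.update μ a l) (S.stopEvent R) ≤ ENNReal.ofReal δ := by
  refine (measure_mono ?_).trans (hS (Function.update μ a l) fun b => ?_)
  · rintro ω ⟨t, h1, h2⟩
    exact ⟨t, h1, hR h2⟩
  · rcases eq_or_ne b a with rfl | hb
    · simpa using hl
    · simpa [hb] using hμ b

lemma tendsto_law_errorEvent {S : ℝ → Strategy K} {θ : ℝ}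
    (hS : ∀ δ : ℝ, 0 < δ → δ < 1 → (S δ).IsCorrect θ δ) {μ : Fin K → ℝ} (hμ : ∀ a, μ a ≠ θ) :
    Tendsto (fun δ => (S δ).law μ ((S δ).stopEvent (wrongAnswers θ μ))) (𝓝[>] 0) (𝓝 0) := by
  have h : Tendsto (fun δ : ℝ => ENNReal.ofReal δ) (𝓝[>] 0) (𝓝 0) := by
    simpa using (ENNReal.continuous_ofReal.tendsto 0).mono_left nhdsWithin_le_nhds
  refine tendsto_of_tendsto_of_tendsto_of_le_of_le' tendsto_const_nhds h
    (Eventually.of_forall fun _ => zero_le) ?_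
  filter_upwards [eventually_mem_Ioo] with δ hδ
  exact hS δ hδ.1 hδ.2 μ hμ

/-! ### The two cases of the characteristic time. -/

lemma gap_sq_pos {θ : ℝ} {μ : Fin K → ℝ} (hμ : ∀ a, μ a ≠ θ) (a : Fin K) :
    0 < gap θ μ a ^ 2 :=
  pow_pos (abs_pos.2 (sub_ne_zero.2 (hμ a))) 2

lemma mul_sub_sq_lt {θ : ℝ} {μ : Fin K → ℝ} (hμ : ∀ a, μ a ≠ θ) (a : Fin K) {r s : ℝ}
    (hs : s < 1) (hr : r ≤ s * (2 * (gap θ μ a ^ 2)⁻¹)) : r * (μ a - θ) ^ 2 < 2 := by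
  have hg := gap_sq_pos hμ a
  rw [← sq_abs]
  change r * gap θ μ a ^ 2 < 2
  calc r * gap θ μ a ^ 2 ≤ s * (2 * (gap θ μ a ^ 2)⁻¹) * gap θ μ a ^ 2 := by gcongr
    _ = 2 * s := by rw [mul_assoc, mul_assoc, inv_mul_cancel₀ hg.ne']; ring
    _ < 2 := by linarith

lemma ofReal_mul_characteristicTime_le_of_nonempty {S : ℝ → Strategy K} {θ : ℝ}
    (hS : ∀ δ : ℝ, 0 < δ → δ < 1 → (S δ).IsCorrect θ δ) {μ : Fin K → ℝ} (hμ : ∀ a, μ a ≠ θ)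
    (hne : (goodArms θ μ).Nonempty) {s : ℝ} (hs0 : 0 ≤ s) (hs1 : s < 1) :
    ENNReal.ofReal (s * characteristicTime θ μ) ≤
      liminf (fun δ : ℝ => (S δ).expectedSamples μ / ENNReal.ofReal (Real.log (1 / δ)))
        (𝓝[>] (0 : ℝ)) := by
  rw [characteristicTime, dif_pos hne]
  set T := (goodArms θ μ).inf' hne fun a => (gap θ μ a ^ 2)⁻¹
  have hT : 0 ≤ T := Finset.le_inf' _ _ fun a _ => inv_nonneg.2 (sq_nonneg _)
  set r := s * (2 * T)
  have hr : 0 ≤ r := by positivity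
  -- Outside `E`, a strategy that stops has named a good arm pulled more than `r * log (1 / δ)`
  -- times.
  set E : ℝ → Set (Path K) := fun δ => (S δ).stopEvent (wrongAnswers θ μ) ∪
    ⋃ a ∈ goodArms θ μ, (S δ).fewPullsEvent {some a} a (r * Real.log (1 / δ))
  have hE : ∀ δ, MeasurableSet (E δ) := fun δ => ((S δ).measurableSet_stopEvent _).union
    (Finset.measurableSet_biUnion _ fun a _ => (S δ).measurableSet_fewPullsEvent _ a _)
  have hfew : ∀ a ∈ goodArms θ μ, Tendsto (fun δ => (S δ).law μ
      ((S δ).fewPullsEvent {some a} a (r * Real.log (1 / δ)))) (𝓝[>] 0) (𝓝 0) := by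
    intro a ha
    have hra : r * (μ a - θ) ^ 2 < 2 := mul_sub_sq_lt hμ a hs1 (by
      have : T ≤ (gap θ μ a ^ 2)⁻¹ := Finset.inf'_le _ ha
      exact mul_le_mul_of_nonneg_left (mul_le_mul_of_nonneg_left this zero_le_two) hs0)
    obtain ⟨l, hl, hrl⟩ := exists_lt_mul_sub_sq_lt hra
    refine tendsto_law_fewPullsEvent S μ _ a l (fun δ h0 h1 => ?_) hr hrl
    refine law_update_stopEvent_le (hS δ h0 h1) hμ hl.ne ?_
    have hna : a ∉ goodArms θ (Function.update μ a l) := by simp [goodArms, hl]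
    rintro _ rfl
    unfold wrongAnswers
    split_ifs
    · exact Or.inr ⟨a, hna, rfl⟩
    · exact Option.some_ne_none a
  have hE0 : Tendsto (fun δ => (S δ).law μ (E δ)) (𝓝[>] 0) (𝓝 0) := by
    have hlim := (tendsto_law_errorEvent hS hμ).add (tendsto_finsetSum _ hfew)
    simp only [Finset.sum_const_zero, add_zero] at hlim
    refine tendsto_of_tendsto_of_tendsto_of_le_of_le tendsto_const_nhds hlim
      (fun _ => zero_le) fun δ => (measure_union_le _ _).trans ?_
    exact add_le_add le_rfl (measure_biUnion_finset_le _ _)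
  have key := sum_le_liminf_expectedSamples S μ {()} (r := fun _ => r) (fun _ _ => hr)
    (w := fun _ δ => (S δ).law μ (E δ)ᶜ) (fun _ _ => tendsto_law_compl S μ hE hE0)
    (Eventually.of_forall fun δ => by
      rw [Finset.sum_singleton]
      refine (S δ).mul_le_expectedSamples μ (hE δ) fun ω t ht htM => ?_
      by_cases hw : (S δ).recommend t (hist t ω) ∈ wrongAnswers θ μ
      · exact Or.inl ⟨t, ht, hw⟩
      · right
        rw [wrongAnswers, if_pos hne] at hw
        simp only [Set.mem_ofPred_eq, not_or, not_exists, not_and] at hw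
        obtain ⟨a, ha⟩ := Option.ne_none_iff_exists'.1 hw.1
        refine Set.mem_biUnion (x := a) (by_contra fun hna => hw.2 a hna ha) ⟨t, ht, ha, ?_⟩
        exact le_trans (Nat.cast_le.2 (pulls_le a _)) htM)
  simpa using key

lemma ofReal_mul_characteristicTime_le_of_not_nonempty {S : ℝ → Strategy K} {θ : ℝ}
    (hS : ∀ δ : ℝ, 0 < δ → δ < 1 → (S δ).IsCorrect θ δ) {μ : Fin K → ℝ} (hμ : ∀ a, μ a ≠ θ)
    (hne : ¬ (goodArms θ μ).Nonempty) {s : ℝ} (hs0 : 0 ≤ s) (hs1 : s < 1) :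
    ENNReal.ofReal (s * characteristicTime θ μ) ≤
      liminf (fun δ : ℝ => (S δ).expectedSamples μ / ENNReal.ofReal (Real.log (1 / δ)))
        (𝓝[>] (0 : ℝ)) := by
  rw [characteristicTime, dif_neg hne, complexityH1, Finset.mul_sum, Finset.mul_sum]
  set r : Fin K → ℝ := fun a => s * (2 * (gap θ μ a ^ 2)⁻¹)
  have hr : ∀ a, 0 ≤ r a := fun a => by positivity
  refine sum_le_liminf_expectedSamples S μ Finset.univ (r := r) (fun a _ => hr a)
    (w := fun a δ => (S δ).law μ
      ((S δ).fewPullsEvent Set.univ a (r a * Real.log (1 / δ)))ᶜ) (fun a _ => ?_)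
    (Eventually.of_forall fun δ => (S δ).sum_le_expectedSamples μ _)
  refine tendsto_law_compl S μ (fun δ => (S δ).measurableSet_fewPullsEvent _ _ _) ?_
  obtain ⟨l, hl, hrl⟩ := exists_gt_mul_sub_sq_lt (mul_sub_sq_lt hμ a hs1 le_rfl : r a * _ < 2)
  have hfew := tendsto_law_fewPullsEvent S μ {none} a l (fun δ h0 h1 => by
    refine law_update_stopEvent_le (hS δ h0 h1) hμ hl.ne' ?_
    have hga : (goodArms θ (Function.update μ a l)).Nonempty :=
      ⟨a, by simpa [goodArms] using hl.le⟩
    rintro _ rfl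
    rw [wrongAnswers, if_pos hga]
    exact Or.inl rfl) (hr a) hrl
  have hlim := (tendsto_law_errorEvent hS hμ).add hfew
  rw [add_zero] at hlim
  refine tendsto_of_tendsto_of_tendsto_of_le_of_le tendsto_const_nhds hlim
    (fun _ => zero_le) fun δ => le_trans (measure_mono ?_) (measure_union_le _ _)
  rintro ω ⟨t, ht, -, hM⟩
  -- With no good arm, every answer but `none` is an error, already of vanishing probability.
  by_cases hw : (S δ).recommend t (hist t ω) = none
  · exact Or.inr ⟨t, ht, hw, hM⟩
  · exact Or.inl ⟨t, ht, by rwa [wrongAnswers, if_neg hne]⟩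

end GoodArm

theorem lemma1 {K : ℕ} (θ : ℝ) (S : ℝ → GoodArm.Strategy K)
    (hS : ∀ δ : ℝ, 0 < δ → δ < 1 → (S δ).IsCorrect θ δ)
    (μ : Fin K → ℝ) (hμ : ∀ a, μ a ≠ θ) :
    ENNReal.ofReal (GoodArm.characteristicTime θ μ) ≤
      liminf (fun δ : ℝ => (S δ).expectedSamples μ / ENNReal.ofReal (Real.log (1 / δ)))
        (𝓝[>] (0 : ℝ)) := by

  have hlim : Tendsto (fun s : ℝ => ENNReal.ofReal (s * GoodArm.characteristicTime θ μ))
      (𝓝[<] 1) (𝓝 (ENNReal.ofReal (1 * GoodArm.characteristicTime θ μ))) :=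
    ((ENNReal.continuous_ofReal.comp (continuous_mul_const _)).tendsto 1).mono_left
      nhdsWithin_le_nhds
  rw [one_mul] at hlim
  -- The factor `s < 1` gives the strict slack needed to move a mean past `θ`.
  refine le_of_tendsto hlim ?_
  filter_upwards [Ioo_mem_nhdsLT (zero_lt_one' ℝ)] with s hs
  by_cases hne : (GoodArm.goodArms θ μ).Nonempty
  · exact GoodArm.ofReal_mul_characteristicTime_le_of_nonempty hS hμ hne hs.1.le hs.2
  · exact GoodArm.ofReal_mul_characteristicTime_le_of_not_nonempty hS hμ hne hs.1.le hs.2
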